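/- Let $\mathcal{R}$ be a first-order structure with underlying set $\mathbb{R}$ that expands $(\mathbb{R},<)$ and is o-minimal, i.e., every subset of $\mathbb{R}$ that is definable in $\mathcal{R}$ with parameters is a finite union of intervals (of possibly zero or infinite length). Let $\overline{\mathbb{R}}=[-\infty,\infty]$, and let $g:\mathbb{R}^n\to\overline{\mathbb{R}}$ be definable in $\mathcal{R}$ with parameters, meaning that the sets $\{(\bar x,y)\in\mathbb{R}^{n+1}: g(\bar x)=y\}$, $\{\bar x\in\mathbb{R}^n: g(\bar x)=\infty\}$ and $\{\bar x\in\mathbb{R}^n: g(\bar x)=-\infty\}$ are definable in $\mathcal{R}$ with parameters. Let $m\ge 0$, let each of $Q_1,\dots,Q_m$ be $\sup$ or $\inf$, and let each of $v_1,\dots,v_m$ be one of the $n$ variables of $g$. Let $f:\mathbb{R}^k\to\overline{\mathbb{R}}$ be a function of $k$ distinct variables $x_1,\dots,x_k$ among the variables of $g$ such that \[ f(x_1,\dots,x_k)=\mathop{Q_1}_{v_1\in\mathbb{R}}\mathop{Q_2}_{v_2\in\mathbb{R}}\cdots\mathop{Q_m}_{v_m\in\mathbb{R}} g \] for all values of the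 variables. Then $f$ is Borel measurable, and it is universally measurable: for every $r\in\overline{\mathbb{R}}$, the set $f^{-1}((r,\infty])$ is measurable with respect to the completion of every $\sigma$-finite Borel measure on $\mathbb{R}^k$. -/

import Mathlib

open FirstOrder MeasureTheory

universe u v

/-- A first-order structure on `ℝ` that expands `(ℝ, <)` is o-minimal if every subset of `ℝ` that
is definable with parameters is a finite union of intervals. The intervals (open, closed, half-open,
bounded or not, degenerate or empty) are the order-connected subsets of `ℝ`. The order has to be
definable, as a primitive symbol or otherwise. -/
structure IsOMinimal (L : FirstOrder.Language.{u, v}) [L.Structure ℝ] : Prop where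
  lt_definable : (Set.univ : Set ℝ).Definable₂ L {p : ℝ × ℝ | p.1 < p.2}
  finite_union : ∀ s : Set ℝ, (Set.univ : Set ℝ).Definable₁ L s →
    ∃ F : Set (Set ℝ), F.Finite ∧ (∀ I ∈ F, I.OrdConnected) ∧ s = ⋃₀ F

/-- A function `g : ℝⁿ → [-∞, ∞]` is definable (with parameters) in a structure on `ℝ` if the sets
`{(x, y) ∈ ℝⁿ⁺¹ : g x = y}`, `{x ∈ ℝⁿ : g x = ∞}` and `{x ∈ ℝⁿ : g x = -∞}` are definable. -/
structure IsDefinableFun (L : FirstOrder.Language.{u, v}) [L.Structure ℝ] {n : ℕ}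
    (g : (Fin n → ℝ) → EReal) : Prop where
  graph : (Set.univ : Set ℝ).Definable L
    {w : Fin (n + 1) → ℝ | g (fun i => w i.castSucc) = ((w (Fin.last n) : ℝ) : EReal)}
  top : (Set.univ : Set ℝ).Definable L {x : Fin n → ℝ | g x = ⊤}
  bot : (Set.univ : Set ℝ).Definable L {x : Fin n → ℝ | g x = ⊥}

/-- The two quantifiers over `ℝ`. -/
inductive Quant where
  | sup
  | inf

/-- `Q_{t ∈ ℝ} h t`, where `Q` is `sup` or `inf`. -/
noncomputable def Quant.apply : Quant → (ℝ → EReal) → EReal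
  | .sup, h => ⨆ t : ℝ, h t
  | .inf, h => ⨅ t : ℝ, h t

/-- `quantify [(Q₁, v₁), …, (Qₘ, vₘ)] g` is `Q₁_{v₁ ∈ ℝ} ⋯ Qₘ_{vₘ ∈ ℝ} g`, where each `vᵢ` is one of
the variables `0, …, n - 1` of `g` (the first entry of the list is the outermost quantifier). It is
written as a function of the values `w` of all the variables; it does not depend on the values of
the quantified ones. -/
noncomputable def quantify {n : ℕ} :
    List (Quant × Fin n) → ((Fin n → ℝ) → EReal) → (Fin n → ℝ) → EReal
  | [], g => g
  | (Q, i) :: q, g => fun w => Q.apply fun t => quantify q g (Function.update w i t)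

/-- A set is universally measurable if it is measurable with respect to the completion of every
σ-finite Borel measure. -/
def IsUniversallyMeasurableSet {X : Type*} [TopologicalSpace X] [MeasurableSpace X] [BorelSpace X]
    (s : Set X) : Prop :=
  ∀ μ : Measure X, SigmaFinite μ → NullMeasurableSet s μ

/-- A function `f : X → [-∞, ∞]` is universally measurable if every `f⁻¹((r, ∞])` is. -/
def IsUniversallyMeasurable {X : Type*} [TopologicalSpace X] [MeasurableSpace X] [BorelSpace X]
    (f : X → EReal) : Prop :=
  ∀ r : EReal, IsUniversallyMeasurableSet (f ⁻¹' Set.Ioi r)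

/-! Every definable set is Borel, by induction on the set of coordinates it depends on
(`measurableSet_of_definable_of_dependsOn`). For one coordinate `i`, split `A` into `U`, where `w i`
is interior to the fibre of `A` along `i`, and `A \ U`, whose fibres are finite by o-minimality.
Both `U` and the complement of `A \ U` have open fibres, so rational intervals in direction `i`
reduce them to definable sets not depending on `w i`. Since `sup` and `inf` turn into `∃` and `∀` on
strict superlevel sets, those of `quantify q g` are definable, hence Borel. -/

namespace Set

open FirstOrder.Language

variable {L : FirstOrder.Language.{u, v}} {M : Type*} [L.Structure M] {A : Set M}
  {α β ι κ : Type*}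

theorem Definable.exists_option {P : (ι → M) → M → Prop}
    (h : A.Definable L {v : Option ι → M | P (fun i => v (some i)) (v none)}) :
    A.Definable L {w : ι → M | ∃ t, P w t} := by
  have h1 := (h.preimage_comp
    (fun o : Option ι => o.elim (Sum.inr () : ι ⊕ Unit) Sum.inl)).exists_of_finite
  convert! h1 using 1
  ext w
  constructor
  · rintro ⟨t, ht⟩
    exact ⟨fun _ => t, ht⟩
  · rintro ⟨u, hu⟩
    exact ⟨u (), hu⟩

theorem Definable.forall_option {P : (ι → M) → M → Prop}
    (h : A.Definable L {v : Option ι → M | P (fun i => v (some i)) (v none)}) :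
    A.Definable L {w : ι → M | ∀ t, P w t} := by
  have h1 := (Definable.exists_option (P := fun w t => ¬ P w t) h.compl).compl
  convert! h1 using 1
  ext w
  simp

/-- Coordinates of a definable set can be fixed at parameters. -/
theorem Definable.sum_elim_const [Finite β] {S : Set (α ⊕ β → M)}
    (h : (univ : Set M).Definable L S) (u : β → M) :
    (univ : Set M).Definable L {v : α → M | Sum.elim v u ∈ S} := by
  -- Pin each parameter coordinate to a definable singleton, then project it away.
  have hc : (univ : Set M).Definable L (⋂ j, {s : α ⊕ β → M | s (Sum.inr j) = u j}) :=
    definable_iInter_of_finite fun j =>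
      (Definable.singleton_of_mem L (mem_univ (u j))).preimage_comp fun _ : Fin 1 => Sum.inr j
  convert! (h.inter hc).exists_of_finite using 1
  ext v
  constructor
  · intro hv
    exact ⟨u, hv, by simp⟩
  · rintro ⟨u', hu', hc'⟩
    have : u' = u := funext fun j => by simpa using mem_iInter.1 hc' j
    exact this ▸ hu'

theorem Definable.update_mem [DecidableEq ι] {S : Set (ι → M)} (h : A.Definable L S) (i : ι)
    (σ : ι → κ) (c : κ) :
    A.Definable L {v : κ → M | Function.update (fun j => v (σ j)) i (v c) ∈ S} := by
  convert! h.preimage_comp (Function.update σ i c) using 1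
  ext v
  rw [mem_preimage, Function.comp_update]
  rfl

theorem Definable.fiber [DecidableEq ι] [Finite ι] {S : Set (ι → M)}
    (h : (univ : Set M).Definable L S) (i : ι) (w : ι → M) :
    (univ : Set M).Definable₁ L {t | Function.update w i t ∈ S} :=
  (h.update_mem i (Sum.inr : ι → Fin 1 ⊕ ι) (Sum.inl 0)).sum_elim_const w

/-- An order-connected set has at most two points at which it is not locally an interval. -/
theorem OrdConnected.finite_diff_interior {I : Set ℝ} (hI : I.OrdConnected) :
    (I \ interior I).Finite := by
  have hl : {y | IsLeast I y}.Finite :=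
    Subsingleton.finite fun _ hx _ hy => hx.unique hy
  have hg : {y | IsGreatest I y}.Finite :=
    Subsingleton.finite fun _ hx _ hy => hx.unique hy
  refine (hl.union hg).subset fun y ⟨hy, hyi⟩ => ?_
  by_contra hcon
  simp only [mem_union, mem_ofPred_eq, not_or, IsLeast, IsGreatest, hy, true_and, lowerBounds,
    upperBounds, not_forall, not_le] at hcon
  obtain ⟨⟨a, ha, hay⟩, b, hb, hyb⟩ := hcon
  exact hyi (mem_interior_iff_mem_nhds.2
    (Filter.mem_of_superset (Icc_mem_nhds hay hyb) (hI.out ha hb)))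

theorem finite_sUnion_diff_interior {F : Set (Set ℝ)} (hF : F.Finite)
    (hI : ∀ I ∈ F, I.OrdConnected) : (⋃₀ F \ interior (⋃₀ F)).Finite := by
  refine (hF.biUnion fun I h => (hI I h).finite_diff_interior).subset ?_
  rintro t ⟨⟨I, hIF, htI⟩, ht⟩
  exact mem_iUnion₂.2 ⟨I, hIF, htI, fun h => ht (interior_mono (subset_sUnion_of_mem hIF) h)⟩

end Set

theorem mem_interior_iff_exists_rat_Ioo {s : Set ℝ} {t : ℝ} :
    t ∈ interior s ↔ ∃ a b : ℚ, t ∈ Set.Ioo (a : ℝ) b ∧ Set.Ioo (a : ℝ) b ⊆ s := by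
  rw [mem_interior_iff_mem_nhds]
  constructor
  · intro h
    obtain ⟨l, r, ⟨hl, hr⟩, hs⟩ := mem_nhds_iff_exists_Ioo_subset.1 h
    obtain ⟨a, hla, hat⟩ := exists_rat_btwn hl
    obtain ⟨b, htb, hbr⟩ := exists_rat_btwn hr
    exact ⟨a, b, ⟨hat, htb⟩, (Set.Ioo_subset_Ioo hla.le hbr.le).trans hs⟩
  · rintro ⟨a, b, ht, hs⟩
    exact Filter.mem_of_superset (Ioo_mem_nhds ht.1 ht.2) hs

/-! ### Definable sets are Borel -/

namespace IsOMinimal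

open Set Function

variable {L : FirstOrder.Language.{u, v}} [L.Structure ℝ] {ι : Type*}

theorem definable_lt (hL : IsOMinimal L) (i j : ι) :
    (univ : Set ℝ).Definable L {w : ι → ℝ | w i < w j} :=
  hL.lt_definable.preimage_comp ![i, j]

theorem definable_lt_const (hL : IsOMinimal L) (i : ι) (c : ℝ) :
    (univ : Set ℝ).Definable L {w : ι → ℝ | w i < c} :=
  (hL.definable_lt (Sum.inl i) (Sum.inr ())).sum_elim_const fun _ : Unit => c

theorem definable_const_lt (hL : IsOMinimal L) (i : ι) (c : ℝ) :
    (univ : Set ℝ).Definable L {w : ι → ℝ | c < w i} :=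
  (hL.definable_lt (Sum.inr ()) (Sum.inl i)).sum_elim_const fun _ : Unit => c

variable [DecidableEq ι] {A : Set (ι → ℝ)}

theorem definable_Ioo_subset_fiber (hL : IsOMinimal L) (hA : (univ : Set ℝ).Definable L A)
    (i : ι) (a b : ℝ) :
    (univ : Set ℝ).Definable L {w : ι → ℝ | Ioo a b ⊆ {t | update w i t ∈ A}} := by
  have h := Definable.forall_option (P := fun (w : ι → ℝ) t => t ∈ Ioo a b → update w i t ∈ A)
    (((hL.definable_const_lt none a).inter (hL.definable_lt_const none b)).himp
      (hA.update_mem i some none))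
  exact h

/-- The topology of `ℝ` is the order topology, so interiority is first-order: quantify over the
endpoints of an interval. -/
theorem definable_fiber_interior (hL : IsOMinimal L) (hA : (univ : Set ℝ).Definable L A)
    (i : ι) :
    (univ : Set ℝ).Definable L {w : ι → ℝ | w i ∈ interior {t | update w i t ∈ A}} := by
  have h := Definable.exists_option (P := fun (w : ι → ℝ) a => ∃ b, w i ∈ Ioo a b ∧
      ∀ t, t ∈ Ioo a b → update w i t ∈ A)
    (Definable.exists_option (P := fun (w : Option ι → ℝ) b => w (some i) ∈ Ioo (w none) b ∧
      ∀ t, t ∈ Ioo (w none) b → update (fun j => w (some j)) i t ∈ A)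
    (((hL.definable_lt (some none) (some (some i))).inter
      (hL.definable_lt (some (some i)) none)).inter
    (Definable.forall_option (P := fun (w : Option (Option ι) → ℝ) t =>
      t ∈ Ioo (w (some none)) (w none) → update (fun j => w (some (some j))) i t ∈ A)
    (((hL.definable_lt (some (some none)) none).inter (hL.definable_lt none (some none))).himp
      (hA.update_mem i (fun j => some (some (some j))) none)))))
  convert! h using 1
  ext w
  simp only [mem_ofPred_eq, mem_interior_iff_mem_nhds, mem_nhds_iff_exists_Ioo_subset]
  rfl

/-- The only place where finiteness of the union of intervals enters. -/
theorem finite_fiber_diff_interior [Finite ι] (hL : IsOMinimal L)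
    (hA : (univ : Set ℝ).Definable L A) (i : ι) (w : ι → ℝ) :
    ({t | update w i t ∈ A} \ interior {t | update w i t ∈ A}).Finite := by
  obtain ⟨F, hF, hI, h⟩ := hL.finite_union _ (hA.fiber i w)
  rw [h]
  exact finite_sUnion_diff_interior hF hI

/-- If the sections of `A` in direction `i` are open, then `A` is a countable union of products
`{w | a < w i < b} ∩ {w | (a, b) ⊆ A_w}`. -/
theorem measurableSet_of_isOpen_fiber (i : ι)
    (hP : ∀ a b : ℚ, MeasurableSet {w : ι → ℝ | Ioo (a : ℝ) b ⊆ {t | update w i t ∈ A}})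
    (hA : ∀ w, IsOpen {t | update w i t ∈ A}) : MeasurableSet A := by
  have h : A = ⋃ (a : ℚ) (b : ℚ), (fun w : ι → ℝ => w i) ⁻¹' Ioo (a : ℝ) b ∩
      {w | Ioo (a : ℝ) b ⊆ {t | update w i t ∈ A}} := by
    ext w
    have : w ∈ A ↔ w i ∈ interior {t | update w i t ∈ A} := by
      rw [(hA w).interior_eq]
      simp
    rw [this, mem_interior_iff_exists_rat_Ioo]
    simp
  rw [h]
  exact .iUnion fun a => .iUnion fun b =>
    ((measurable_pi_apply i) measurableSet_Ioo).inter (hP a b)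

theorem measurableSet_of_definable_of_dependsOn [Finite ι] (hL : IsOMinimal L) (s : Finset ι) :
    ∀ A : Set (ι → ℝ), (univ : Set ℝ).Definable L A → DependsOn (· ∈ A) (s : Set ι) →
      MeasurableSet A := by
  induction s using Finset.induction_on with
  | empty =>
    intro A _ hdep
    have : ∀ w w' : ι → ℝ, (w ∈ A) = (w' ∈ A) := fun w w' => hdep (by simp)
    rcases A.eq_empty_or_nonempty with rfl | ⟨w, hw⟩
    · exact .empty
    · rw [show A = univ from eq_univ_of_forall fun w' => (this w w').mp hw]
      exact .univ
  | insert i s _ ih =>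
    have key : ∀ B : Set (ι → ℝ), (univ : Set ℝ).Definable L B →
        DependsOn (· ∈ B) ((insert i s : Finset ι) : Set ι) →
        (∀ w, IsOpen {t | update w i t ∈ B}) → MeasurableSet B := by
      intro B hB hdep hop
      -- `update` overwrites coordinate `i`, so the set of `w` whose fibre contains `(a, b)` depends
      -- on `s` alone.
      refine measurableSet_of_isOpen_fiber i (fun a b => ih _
        (hL.definable_Ioo_subset_fiber hB i a b) fun w w' hw => ?_) hop
      have : ∀ t, (update w i t ∈ B) = (update w' i t ∈ B) := fun t => hdep fun j hj => by
        by_cases h : j = i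
        · subst h; simp
        · simpa [h] using hw j (by simpa [h] using hj)
      simp only [mem_ofPred_eq, this]
    intro A hA hdep
    have hfib : ∀ w w' : ι → ℝ, (∀ j ∈ ((insert i s : Finset ι) : Set ι), w j = w' j) →
        {t | update w i t ∈ A} = {t | update w' i t ∈ A} := fun w w' hw => by
      ext t
      refine (hdep fun j hj => ?_).to_iff
      by_cases h : j = i
      · subst h; simp
      · simpa [h] using hw j hj
    set U : Set (ι → ℝ) := {w | w i ∈ interior {t | update w i t ∈ A}} with hU
    have hUdef : (univ : Set ℝ).Definable L U := hL.definable_fiber_interior hA i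
    have hUdep : DependsOn (· ∈ U) ((insert i s : Finset ι) : Set ι) := fun w w' hw => by
      simp only [hU, mem_ofPred_eq]
      rw [hfib w w' hw, hw i (by simp)]
    have hUfib : ∀ w, {t | update w i t ∈ U} = interior {t | update w i t ∈ A} := fun w => by
      ext t
      simp [hU]
    have hUA : U ⊆ A := fun w hw => by
      have := interior_subset hw
      simpa using this
    have hUm : MeasurableSet U := key U hUdef hUdep fun w => by
      rw [hUfib]
      exact isOpen_interior
    -- Finite fibres are closed, so `key` applies to the complement.
    have hCm : MeasurableSet (A \ U)ᶜ := by
      refine key _ (hA.sdiff hUdef).compl (fun w w' hw => ?_) fun w => ?_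
      · have h1 : (w ∈ A) = (w' ∈ A) := hdep hw
        have h2 : (w ∈ U) = (w' ∈ U) := hUdep hw
        simp only [mem_compl_iff, mem_sdiff, h1, h2]
      · have : {t | update w i t ∈ (A \ U)ᶜ} =
            ({t | update w i t ∈ A} \ interior {t | update w i t ∈ A})ᶜ := by
          rw [← hUfib]
          rfl
        rw [this]
        exact (hL.finite_fiber_diff_interior hA i w).isClosed.isOpen_compl
    rw [← union_sdiff_cancel hUA]
    exact hUm.union hCm.of_compl

/-- Sets definable in an o-minimal structure on `ℝ` are Borel. -/
theorem measurableSet_of_definable [Finite ι] (hL : IsOMinimal L)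
    (hA : (univ : Set ℝ).Definable L A) : MeasurableSet A := by
  have := Fintype.ofFinite ι
  exact hL.measurableSet_of_definable_of_dependsOn Finset.univ A hA fun w w' hw => by
    rw [show w = w' from funext fun j => hw j (by simp)]

end IsOMinimal

/-! ### Superlevel sets of `g` and of the quantified function -/

namespace IsDefinableFun

open Set Function

variable {L : FirstOrder.Language.{u, v}} [L.Structure ℝ] {n : ℕ} {g : (Fin n → ℝ) → EReal}

theorem definable_lt (hg : IsDefinableFun L g) (hL : IsOMinimal L) :
    (univ : Set ℝ).Definable L
      {v : Option (Fin n) → ℝ | (v none : EReal) < g fun i => v (some i)} := by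
  have h1 := hg.top.preimage_comp (some : Fin n → Option (Fin n))
  have h2 := Definable.exists_option
    (P := fun (v : Option (Fin n) → ℝ) y => g (fun i => v (some i)) = (y : EReal) ∧ v none < y)
    (by
      convert! (hg.graph.preimage_comp (Fin.lastCases none fun j => some (some j) :
        Fin (n + 1) → Option (Option (Fin n)))).inter (hL.definable_lt (some none) none) using 1
      ext v
      simp)
  convert! h1.union h2 using 1
  ext v
  simp only [mem_union, mem_preimage, mem_ofPred_eq, comp_def]
  generalize g (fun i => v (some i)) = y
  induction y with
  | bot => simp
  | top => simp
  | coe y => simp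

end IsDefinableFun

open Set Function in
theorem definable_lt_quantify {L : FirstOrder.Language.{u, v}} [L.Structure ℝ]
    (hL : IsOMinimal L) {n : ℕ} {g : (Fin n → ℝ) → EReal} (hg : IsDefinableFun L g)
    (q : List (Quant × Fin n)) :
    (univ : Set ℝ).Definable L
      {v : Option (Fin n) → ℝ | (v none : EReal) < quantify q g fun i => v (some i)} := by
  induction q with
  | nil => exact hg.definable_lt hL
  | cons a q ih =>
    obtain ⟨Q, i⟩ := a
    have hsub : ∀ {κ : Type} (σ : Fin n → κ) (c d : κ), (univ : Set ℝ).Definable L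
        {v : κ → ℝ | (v d : EReal) < quantify q g (update (fun j => v (σ j)) i (v c))} := by
      intro κ σ c d
      convert! ih.preimage_comp (fun o => o.elim d (update σ i c)) using 1
      ext v
      have : update (fun j => v (σ j)) i (v c) = fun j => v (update σ i c j) :=
        (comp_update v σ i c).symm
      rw [mem_ofPred_eq, this]
      rfl
    cases Q with
    | sup =>
      have h := Definable.exists_option (P := fun (v : Option (Fin n) → ℝ) t =>
        (v none : EReal) < quantify q g (update (fun j => v (some j)) i t))
        (hsub (fun j => some (some j)) none (some none))
      convert! h using 1
      ext v
      simp only [mem_ofPred_eq, quantify, Quant.apply, lt_iSup_iff]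
    | inf =>
      -- An infimum of values above the level may equal the level; a real `s` strictly between
      -- restores strictness.
      have h := Definable.exists_option (P := fun (v : Option (Fin n) → ℝ) s => v none < s ∧
          ∀ t : ℝ, (s : EReal) < quantify q g (update (fun j => v (some j)) i t))
        ((hL.definable_lt (some none) none).inter
        (Definable.forall_option (P := fun (v : Option (Option (Fin n)) → ℝ) t =>
          (v none : EReal) < quantify q g (update (fun j => v (some (some j))) i t))
        (hsub (fun j => some (some (some j))) none (some none))))
      convert! h using 1
      ext v
      simp only [mem_ofPred_eq, quantify, Quant.apply]
      constructor
      · intro hv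
        obtain ⟨s, hs, hs'⟩ := EReal.lt_iff_exists_real_btwn.1 hv
        exact ⟨s, EReal.coe_lt_coe_iff.1 hs, fun t => hs'.trans_le (iInf_le _ t)⟩
      · rintro ⟨s, hs, hs'⟩
        exact (EReal.coe_lt_coe_iff.2 hs).trans_le (le_iInf fun t => (hs' t).le)

open Set Function in
theorem measurable_quantify {L : FirstOrder.Language.{u, v}} [L.Structure ℝ]
    (hL : IsOMinimal L) {n : ℕ} {g : (Fin n → ℝ) → EReal} (hg : IsDefinableFun L g)
    (q : List (Quant × Fin n)) : Measurable (quantify q g) := by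
  have hreal : ∀ r : ℝ, MeasurableSet (quantify q g ⁻¹' Ioi (r : EReal)) := fun r =>
    hL.measurableSet_of_definable
      (((definable_lt_quantify hL hg q).preimage_comp fun o : Option (Fin n) =>
        o.elim (Sum.inr () : Fin n ⊕ Unit) Sum.inl).sum_elim_const fun _ => r)
  refine measurable_of_Ioi fun r => ?_
  -- Definability covers real levels only; rational levels above `r` also reach `r = ±∞`.
  have : quantify q g ⁻¹' Ioi r =
      ⋃ (a : ℚ) (_ : r < ((a : ℝ) : EReal)), quantify q g ⁻¹' Ioi ((a : ℝ) : EReal) := by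
    ext w
    simp only [mem_preimage, mem_Ioi, mem_iUnion, exists_prop]
    constructor
    · intro h
      exact EReal.lt_iff_exists_rat_btwn.1 h
    · rintro ⟨a, h, h'⟩
      exact h.trans h'
  rw [this]
  exact .iUnion fun a => .iUnion fun _ => hreal a

/-- The injection `e` says which of the variables of `g` are the arguments of `f`. -/
theorem mainTheorem9 (L : FirstOrder.Language.{u, v}) [L.Structure ℝ] (hL : IsOMinimal L)
    (n : ℕ) (g : (Fin n → ℝ) → EReal) (hg : IsDefinableFun L g)
    (q : List (Quant × Fin n))
    (k : ℕ) (e : Fin k → Fin n) (he : Function.Injective e)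
    (f : (Fin k → ℝ) → EReal)
    (hf : ∀ w : Fin n → ℝ, f (fun j => w (e j)) = quantify q g w) :
    Measurable f ∧ IsUniversallyMeasurable f := by
  -- By `hf` the variables outside the range of `e` do not matter; they are set to `0`.
  have hE : Measurable fun (x : Fin k → ℝ) => Function.extend e x 0 := by
    refine measurable_pi_lambda _ fun i => ?_
    by_cases h : ∃ j, e j = i
    · obtain ⟨j, rfl⟩ := h
      simpa only [he.extend_apply] using measurable_pi_apply j
    · simpa only [Function.extend_apply' _ _ _ h] using measurable_const
  have hfm : Measurable f := by
    have : f = fun x => quantify q g (Function.extend e x 0) := by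
      ext x
      rw [← hf]
      simp only [he.extend_apply]
    rw [this]
    exact (measurable_quantify hL hg q).comp hE
  exact ⟨hfm, fun r μ _ => (hfm measurableSet_Ioi).nullMeasurableSet⟩
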